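/- Let $H$ be a group and let $\ell\colon H\to\{0,1,2,\dots\}$ be a length function on $H$, that is, $\ell(h)=0$ if and only if $h=1$, $\ell(h)=\ell(h^{-1})$, and $\ell(gh)\le \ell(g)+\ell(h)$ for all $g,h\in H$. Suppose that the growth of $H$ with respect to $\ell$ is at most exponential, that is, there is a constant $a$ such that for every positive integer $n$ the set $\{h\in H \mid \ell(h)\le n\}$ is finite and has at most $a^n$ elements. Then $H$ embeds as a subgroup in a group $G$ generated by a finite set $X$ such that the following two conditions hold, where $|g|_X$ denotes the length of a shortest word in the elements of $X$ and their inverses that represents $g\in G$. (a) There exists $c>0$ such that $c\,|h|_X\le \ell(h)\le |h|_X$ for every $h\in H$. (b) $G$ has normal subgroups $G_1\le G_2$ such that $G_1$ is abelian and $G_1\cap H=\{1\}$; every finitely generated subgroup of $G_2/G_1$ embeds in a direct product of finitely many copies of $H$; and $G/G_2$ is solvable of derived length at most $3$. -/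

import Mathlib

universe u v

/-- `ℓ` is a length function on the group `H`, with values in the nonnegative integers. -/
structure IsLengthFunction {H : Type u} [Group H] (ℓ : H → ℕ) : Prop where
  eq_zero_iff : ∀ h : H, ℓ h = 0 ↔ h = 1
  inv : ∀ h : H, ℓ h = ℓ h⁻¹
  mul_le : ∀ g h : H, ℓ (g * h) ≤ ℓ g + ℓ h

/-- The growth of `H` with respect to `ℓ` is at most exponential: for some constant `a`, every
ball of positive integer radius `n` is finite and has at most `a ^ n` elements. -/
def GrowthAtMostExponential {H : Type u} (ℓ : H → ℕ) : Prop :=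
  ∃ a : ℝ, ∀ n : ℕ, 1 ≤ n →
    {h : H | ℓ h ≤ n}.Finite ∧ ({h : H | ℓ h ≤ n}.ncard : ℝ) ≤ a ^ n

/-- The word length `|g|_X`: the least length of a word in letters from `X` and their inverses
that represents `g`. It is meaningful for `g` in the subgroup generated by `X`. -/
noncomputable def wordLength {G : Type u} [Group G] (X : Set G) (g : G) : ℕ :=
  sInf {n : ℕ | ∃ w : List G, (∀ x ∈ w, x ∈ X ∨ x⁻¹ ∈ X) ∧ w.prod = g ∧ w.length = n}

/-- `K` belongs to the class `𝓔(H)`: every finitely generated subgroup of `K` embeds in a finite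
direct power of `H`. -/
def LocallyEmbedsInPowers (H : Type u) [Group H] (K : Type v) [Group K] : Prop :=
  ∀ L : Subgroup K, L.FG → ∃ (n : ℕ) (f : L →* (Fin n → H)), Function.Injective f

/-! `G` is a group of permutations of tuples (position, level, value, counter), generated by two
unit translations and the doubling of the rational plane, a step `s`, and a shift `b` that raises
the level over the origin. Each `h` in `H` has an address `(N h, N h ^ 2)` on a parabola, with `N h`
between `4 ^ ℓ h` and an exponential in `ℓ h`. At the address of `h`, `s` multiplies the value by
`h` on nonnegative levels; on negative levels it only changes the counter. Once `s` is translated so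
that this address lies over the origin, its commutator with `b` cancels everywhere except over the
origin at level 0, where it multiplies the value by `h` and adds to the counter the increment of `F`
(`embedPerm_eq_commutator`). This is the embedding of `H`.

Upper bound on word length: doubling makes translation by `N` cost O(log N) letters, hence O(ℓ h)
(`hasWord_embedPerm`). Lower bound: `F` is the family of ball indicators, so `h` applied to the base
point leaves exactly `ℓ h` nonzero places in the counter. The invariant `Budget` shows that a word
of length n ending on a nonnegative level leaves at most n. Addresses as large as `4 ^ ℓ h` are
remote enough for the travel to pay for the change made there, with constant 1.

Normal structure: `levelKernel` and `valueKernel` cut out G₂ and G₁. Elements of G₁ translate the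
counter by amounts independent of it, so they commute. G₂ modulo G₁ consists of multipliers,
`H`-valued functions of position and level, and finitely many of them are determined by finitely
many coordinates. Modulo G₂, two derivations remove the homotheties and a third removes the rest:
distinct homothetic images of the parabola meet in a finite set, so elements fixing positions
commute over all but finitely many positions. -/

/-! ### Homotheties of the plane and the parabola -/

namespace SkewEmbedding

/-- The affine maps `y ↦ c • y + w` of the rational plane whose linear part is scalar. -/
def homotheties : Subgroup (Equiv.Perm (ℚ × ℚ)) where
  carrier := {σ | ∃ c : ℚ, c ≠ 0 ∧ ∃ w : ℚ × ℚ, ∀ y, σ y = c • y + w}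
  mul_mem' := by
    rintro σ τ ⟨c, hc, w, hσ⟩ ⟨c', hc', w', hτ⟩
    refine ⟨c * c', mul_ne_zero hc hc', c • w' + w, fun y => ?_⟩
    rw [Equiv.Perm.mul_apply, hτ, hσ, smul_add, smul_smul, add_assoc]
  one_mem' := ⟨1, one_ne_zero, 0, by simp⟩
  inv_mem' := by
    rintro σ ⟨c, hc, w, hσ⟩
    refine ⟨c⁻¹, inv_ne_zero hc, -(c⁻¹ • w), fun y => ?_⟩
    rw [Equiv.Perm.inv_eq_iff_eq, hσ, smul_add, smul_neg, smul_smul, smul_smul,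
      mul_inv_cancel₀ hc]
    simp

theorem addRight_mem_homotheties (w : ℚ × ℚ) : Equiv.addRight w ∈ homotheties :=
  ⟨1, one_ne_zero, w, by simp⟩

/-- The homothety `y ↦ 2 • y`. -/
def double : Equiv.Perm (ℚ × ℚ) where
  toFun y := (2 : ℚ) • y
  invFun y := (2⁻¹ : ℚ) • y
  left_inv y := by simp [smul_smul]
  right_inv y := by simp [smul_smul]

theorem double_mem_homotheties : double ∈ homotheties :=
  ⟨2, two_ne_zero, 0, fun y => by simp [double]⟩

/-- The integer points of the parabola. -/
def parabola : Set (ℚ × ℚ) := {y | ∃ N : ℕ, y = ((N : ℚ), (N : ℚ) ^ 2)}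

theorem finite_setOf_quadratic_eq_zero {a b c : ℚ} (h : a ≠ 0 ∨ b ≠ 0 ∨ c ≠ 0) :
    {t : ℚ | a * t ^ 2 + b * t + c = 0}.Finite := by
  have hp : (Polynomial.C a * Polynomial.X ^ 2 + Polynomial.C b * Polynomial.X
      + Polynomial.C c : Polynomial ℚ) ≠ 0 := by
    intro h0
    have h2 := congrArg (fun p => Polynomial.coeff p 2) h0
    have h1 := congrArg (fun p => Polynomial.coeff p 1) h0
    have h3 := congrArg (fun p => Polynomial.coeff p 0) h0
    simp [Polynomial.coeff_X, Polynomial.coeff_C] at h1 h2 h3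
    tauto
  refine (Polynomial.finite_setOfPred_isRoot hp).subset fun t ht => ?_
  simpa [Polynomial.IsRoot] using ht

/-- Distinct homotheties carry the parabola to sets with finite intersection. -/
theorem finite_image_parabola_inter {σ τ : Equiv.Perm (ℚ × ℚ)} (hσ : σ ∈ homotheties)
    (hτ : τ ∈ homotheties) (hne : σ ≠ τ) :
    {y | σ⁻¹ y ∈ parabola ∧ τ⁻¹ y ∈ parabola}.Finite := by
  obtain ⟨c, hc, w, h⟩ := homotheties.mul_mem (homotheties.inv_mem hτ) hσ
  -- A point `(t, t ^ 2)` goes to a point of the parabola only if `(c * t + w.1) ^ 2 = c * t ^ 2 +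
  -- w.2`. These are the coefficients of that quadratic in `t`; all vanish only for the identity.
  have key : (c ^ 2 - c ≠ 0 ∨ 2 * c * w.1 ≠ 0 ∨ w.1 ^ 2 - w.2 ≠ 0) := by
    by_contra! hcon
    obtain ⟨h1, h2, h3⟩ := hcon
    have hc1 : c = 1 := by
      have : c * (c - 1) = 0 := by linarith
      rcases mul_eq_zero.1 this with h0 | h0
      · exact absurd h0 hc
      · linarith
    have hw1 : w.1 = 0 := by
      rcases mul_eq_zero.1 h2 with h0 | h0
      · exact absurd h0 (by simpa using hc)
      · exact h0
    have hw2 : w.2 = 0 := by rw [hw1] at h3; linarith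
    apply hne
    have : τ⁻¹ * σ = 1 := by
      ext y : 1
      rw [h, hc1, show w = 0 from Prod.ext hw1 hw2]
      simp
    exact (inv_mul_eq_one.1 this).symm
  refine ((finite_setOf_quadratic_eq_zero key).image (fun t : ℚ => σ (t, t ^ 2))).subset ?_
  rintro y ⟨⟨N, hN⟩, ⟨M, hM⟩⟩
  have hy : σ (σ⁻¹ y) = y := σ.apply_symm_apply y
  refine ⟨N, ?_, ?_⟩
  · have h' := h (σ⁻¹ y)
    rw [Equiv.Perm.mul_apply, hy, hM, hN] at h'
    have e1 := congrArg Prod.fst h'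
    have e2 := congrArg Prod.snd h'
    simp only [Prod.fst_add, Prod.snd_add, Prod.smul_fst, Prod.smul_snd, smul_eq_mul] at e1 e2
    rw [e1] at e2
    simp only [Set.mem_ofPred_eq]
    linarith
  · simp only [← hN, hy]


/-! ### The action and the commutator that yields `H` -/

/-- The space on which the ambient group acts: a position in the plane, a level, a value in `H`
and an integer-valued counter. -/
abbrev Point (H : Type u) : Type u := (ℚ × ℚ) × ℤ × H × (ℕ → ℤ)

/-- The permutation of `Point H` moving positions only. -/
def movePosition {H : Type u} : Equiv.Perm (ℚ × ℚ) →* Equiv.Perm (Point H) where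
  toFun σ := Equiv.prodCongr σ (Equiv.refl _)
  map_one' := rfl
  map_mul' _ _ := rfl

@[simp]
theorem movePosition_apply {H : Type u} (σ : Equiv.Perm (ℚ × ℚ)) (p : Point H) :
    movePosition σ p = (σ p.1, p.2) := rfl

variable {H : Type u} [Group H]

/-- On nonnegative levels, multiply the value by `γ` of the position; on negative levels, record
in the counter the increment that multiplication would have caused to `F`. -/
def stepPerm (γ : ℚ × ℚ → H) (F : H → ℕ → ℤ) : Equiv.Perm (Point H) where
  toFun p := (p.1, p.2.1, if 0 ≤ p.2.1 then γ p.1 * p.2.2.1 else p.2.2.1,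
    if 0 ≤ p.2.1 then p.2.2.2 else p.2.2.2 + (F p.2.2.1 - F (γ p.1 * p.2.2.1)))
  invFun p := (p.1, p.2.1, if 0 ≤ p.2.1 then (γ p.1)⁻¹ * p.2.2.1 else p.2.2.1,
    if 0 ≤ p.2.1 then p.2.2.2 else p.2.2.2 - (F p.2.2.1 - F (γ p.1 * p.2.2.1)))
  left_inv := by
    rintro ⟨y, i, x, e⟩
    by_cases hi : 0 ≤ i <;> simp [hi]
  right_inv := by
    rintro ⟨y, i, x, e⟩
    by_cases hi : 0 ≤ i <;> simp [hi]

theorem stepPerm_apply (γ : ℚ × ℚ → H) (F : H → ℕ → ℤ) (y i x e) :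
    stepPerm γ F (y, i, x, e) = (y, i, if 0 ≤ i then γ y * x else x,
      if 0 ≤ i then e else e + (F x - F (γ y * x))) := rfl

theorem stepPerm_inv_apply (γ : ℚ × ℚ → H) (F : H → ℕ → ℤ) (y i x e) :
    (stepPerm γ F)⁻¹ (y, i, x, e) = (y, i, if 0 ≤ i then (γ y)⁻¹ * x else x,
      if 0 ≤ i then e else e - (F x - F (γ y * x))) := rfl

/-- Raise the level by one at the origin. -/
def shiftPerm (H : Type u) : Equiv.Perm (Point H) where
  toFun p := (p.1, p.2.1 + (if p.1 = 0 then 1 else 0), p.2.2)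
  invFun p := (p.1, p.2.1 - (if p.1 = 0 then 1 else 0), p.2.2)
  left_inv p := by simp
  right_inv p := by simp

theorem shiftPerm_apply {H : Type u} (y i) (x : H) (e) :
    shiftPerm H (y, i, x, e) = (y, i + (if y = 0 then 1 else 0), x, e) := rfl

theorem shiftPerm_inv_apply {H : Type u} (y i) (x : H) (e) :
    (shiftPerm H)⁻¹ (y, i, x, e) = (y, i - (if y = 0 then 1 else 0), x, e) := rfl

/-- The action of `h` at the origin and level zero, with `F` accounted for in the counter. -/
def embedFun (F : H → ℕ → ℤ) (h : H) (p : Point H) : Point H :=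
  if p.1 = 0 ∧ p.2.1 = 0 then
    (p.1, p.2.1, h * p.2.2.1, p.2.2.2 + (F (h * p.2.2.1) - F p.2.2.1)) else p

theorem embedFun_one (F : H → ℕ → ℤ) (p : Point H) : embedFun F 1 p = p := by
  simp [embedFun]

theorem embedFun_mul (F : H → ℕ → ℤ) (g h : H) (p : Point H) :
    embedFun F (g * h) p = embedFun F g (embedFun F h p) := by
  by_cases hp : p.1 = 0 ∧ p.2.1 = 0
  · simp only [embedFun, if_pos hp, mul_assoc]
    congr 3
    abel
  · simp only [embedFun, if_neg hp]

/-- The action of `H` on `Point H` by `embedFun`. -/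
def embedPerm (F : H → ℕ → ℤ) : H →* Equiv.Perm (Point H) where
  toFun h :=
    { toFun := embedFun F h
      invFun := embedFun F h⁻¹
      left_inv := fun p => by rw [← embedFun_mul, inv_mul_cancel, embedFun_one]
      right_inv := fun p => by rw [← embedFun_mul, mul_inv_cancel, embedFun_one] }
  map_one' := Equiv.ext (embedFun_one F)
  map_mul' g h := Equiv.ext (embedFun_mul F g h)

theorem embedPerm_apply (F : H → ℕ → ℤ) (h : H) (y i x e) :
    embedPerm F h (y, i, x, e) = if y = 0 ∧ i = 0 then
      (y, i, h * x, e + (F (h * x) - F x)) else (y, i, x, e) := rfl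

theorem embedPerm_injective (F : H → ℕ → ℤ) : Function.Injective (embedPerm F) := by
  intro g h hgh
  have := congrArg (fun σ : Equiv.Perm (Point H) => (σ (0, 0, 1, 0)).2.2.1) hgh
  simpa [embedPerm_apply] using this

/-- The element of `H` given by `γ` at `w` is a commutator. -/
theorem embedPerm_eq_commutator (γ : ℚ × ℚ → H) (F : H → ℕ → ℤ) (w : ℚ × ℚ)
    {g : H} (hγ : γ w = g) :
    embedPerm F g = (movePosition (Equiv.addRight w))⁻¹ * stepPerm γ F
      * movePosition (Equiv.addRight w) * shiftPerm H
      * ((movePosition (Equiv.addRight w))⁻¹ * (stepPerm γ F)⁻¹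
      * movePosition (Equiv.addRight w)) * (shiftPerm H)⁻¹ := by
  subst hγ
  ext1 ⟨y, i, x, e⟩
  rw [← map_inv]
  have hinv : ∀ z : ℚ × ℚ, (Equiv.addRight w)⁻¹ z = z - w := fun z => by
    rw [Equiv.Perm.inv_eq_iff_eq]; simp
  simp only [Equiv.Perm.mul_apply, shiftPerm_inv_apply, movePosition_apply, stepPerm_inv_apply,
    stepPerm_apply, shiftPerm_apply, embedPerm_apply, hinv, Equiv.coe_addRight,
    add_sub_cancel_right]
  by_cases hy : y = 0
  · subst hy
    -- Over the origin the inverse step acts on level `i - 1` and the step on level `i`. They cancel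
    -- unless these levels have different signs, that is, unless `i = 0`.
    rcases lt_trichotomy i 0 with hi | hi | hi
    · have h1 : ¬ (0 ≤ i) := by omega
      have h2 : ¬ (1 ≤ i) := by omega
      simp [h1, h2, hi.ne]
    · subst hi
      simp
      abel
    · have h1 : (0 ≤ i) := by omega
      have h3 : 1 ≤ i := by omega
      simp [h1, h3, hi.ne']
  · by_cases hi : 0 ≤ i <;> simp [hy, hi]

end SkewEmbedding

/-! ### Supports and the kernels of the action -/

namespace SkewEmbedding

open scoped commutatorElement

variable {H : Type u}

/-- The permutations leaving a function invariant. -/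
def invariance {α : Type*} {β : Type*} (f : α → β) : Subgroup (Equiv.Perm α) where
  carrier := {g | ∀ a, f (g a) = f a}
  mul_mem' {g h} hg hh a := by rw [Equiv.Perm.mul_apply, hg, hh]
  one_mem' _ := rfl
  inv_mem' {g} hg a := by
    rw [← hg (g⁻¹ a)]
    exact congrArg f (g.apply_symm_apply a)

theorem mem_invariance {α : Type*} {β : Type*} {f : α → β} {g : Equiv.Perm α} :
    g ∈ invariance f ↔ ∀ a, f (g a) = f a := Iff.rfl

/-- The positions over which a permutation is not the identity. -/
def support (g : Equiv.Perm (Point H)) : Set (ℚ × ℚ) := {y | ∃ q, g (y, q) ≠ (y, q)}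

theorem apply_eq_of_notMem_support {g : Equiv.Perm (Point H)} {y q} (h : y ∉ support g) :
    g (y, q) = (y, q) := by
  by_contra hne
  exact h ⟨q, hne⟩

/-- The permutations that preserve positions and are the identity over all but finitely many
positions. -/
def finitary (H : Type u) : Subgroup (Equiv.Perm (Point H)) where
  carrier := {g | g ∈ invariance (fun p : Point H => p.1) ∧ (support g).Finite}
  mul_mem' := by
    rintro g h ⟨hg, hg'⟩ ⟨hh, hh'⟩
    refine ⟨(invariance _).mul_mem hg hh, (hg'.union hh').subset ?_⟩
    rintro y ⟨q, hq⟩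
    by_contra hcon
    simp only [Set.mem_union, not_or] at hcon
    rw [Equiv.Perm.mul_apply, apply_eq_of_notMem_support hcon.2,
      apply_eq_of_notMem_support hcon.1] at hq
    exact hq rfl
  one_mem' := ⟨(invariance _).one_mem, by simp [support]⟩
  inv_mem' := by
    rintro g ⟨hg, hg'⟩
    refine ⟨(invariance _).inv_mem hg, hg'.subset ?_⟩
    rintro y ⟨q, hq⟩
    refine ⟨q, fun h => hq ?_⟩
    rw [Equiv.Perm.inv_eq_iff_eq, h]

/-- The finitary permutations that preserve levels. -/
def levelKernel (H : Type u) : Subgroup (Equiv.Perm (Point H)) :=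
  finitary H ⊓ invariance (fun p : Point H => p.2.1)

/-- The finitary permutations that preserve levels and values. -/
def valueKernel (H : Type u) : Subgroup (Equiv.Perm (Point H)) :=
  levelKernel H ⊓ invariance (fun p : Point H => p.2.2.1)

theorem conj_mem_invariance {α : Type*} {β : Type*} {f : α → β} {g n : Equiv.Perm α}
    (h : ∀ a, f (g (n a)) = f (g a)) : g * n * g⁻¹ ∈ invariance f := by
  intro a
  obtain ⟨b, rfl⟩ := g.surjective a
  rw [Equiv.Perm.mul_apply, Equiv.Perm.mul_apply,
    show g⁻¹ (g b) = b from g.symm_apply_apply b, h]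

/-- The positions over which two permutations do not commute. -/
def noncommuting (g h : Equiv.Perm (Point H)) : Set (ℚ × ℚ) :=
  {y | ∃ q, g (h (y, q)) ≠ h (g (y, q))}

theorem noncommuting_symm (g h : Equiv.Perm (Point H)) :
    noncommuting g h = noncommuting h g := by
  ext y
  simp only [noncommuting, Set.mem_ofPred_eq, ne_comm]

/-- Since `g'` fixes positions, everything happens in the fibre over one position, where commuting
with both factors gives commuting with the product. -/
theorem noncommuting_mul_subset {g g' h : Equiv.Perm (Point H)}
    (hg' : g' ∈ invariance (fun p : Point H => p.1)) :
    noncommuting (g * g') h ⊆ noncommuting g h ∪ noncommuting g' h := by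
  rintro y ⟨q, hq⟩
  by_contra hcon
  simp only [Set.mem_union, not_or, noncommuting, Set.mem_ofPred_eq, not_exists, not_not] at hcon
  apply hq
  obtain ⟨r, hr⟩ : ∃ r, g' (y, q) = (y, r) := ⟨(g' (y, q)).2, Prod.ext (hg' (y, q)) rfl⟩
  rw [Equiv.Perm.mul_apply, Equiv.Perm.mul_apply, hcon.2 q, hr, hcon.1 r]

theorem noncommuting_inv_subset {g h : Equiv.Perm (Point H)}
    (hg : g ∈ invariance (fun p : Point H => p.1)) :
    noncommuting g⁻¹ h ⊆ noncommuting g h := by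
  rintro y ⟨q, hq⟩
  by_contra hcon
  simp only [noncommuting, Set.mem_ofPred_eq, not_exists, not_not] at hcon
  apply hq
  obtain ⟨r, hr⟩ : ∃ r, g⁻¹ (y, q) = (y, r) :=
    ⟨(g⁻¹ (y, q)).2, Prod.ext ((invariance _).inv_mem hg (y, q)) rfl⟩
  have h1 := hcon r
  rw [hr, Equiv.Perm.inv_eq_iff_eq, h1, ← hr]
  exact congrArg h (g.apply_symm_apply _).symm

theorem noncommuting_subset_inter_support {g h : Equiv.Perm (Point H)}
    (hg : g ∈ invariance (fun p : Point H => p.1))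
    (hh : h ∈ invariance (fun p : Point H => p.1)) :
    noncommuting g h ⊆ support g ∩ support h := by
  rintro y ⟨q, hq⟩
  by_contra hcon
  apply hq
  obtain ⟨r, hr⟩ : ∃ r, g (y, q) = (y, r) := ⟨(g (y, q)).2, Prod.ext (hg (y, q)) rfl⟩
  obtain ⟨s, hs⟩ : ∃ r, h (y, q) = (y, r) := ⟨(h (y, q)).2, Prod.ext (hh (y, q)) rfl⟩
  by_cases hy : y ∈ support g
  · have hy' : y ∉ support h := fun h' => hcon ⟨hy, h'⟩
    rw [apply_eq_of_notMem_support hy', hr, apply_eq_of_notMem_support hy']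
  · rw [apply_eq_of_notMem_support hy, hs, apply_eq_of_notMem_support hy]

theorem support_commutator_subset {g h : Equiv.Perm (Point H)}
    (hg : g ∈ invariance (fun p : Point H => p.1))
    (hh : h ∈ invariance (fun p : Point H => p.1)) :
    support ⁅g, h⁆ ⊆ noncommuting g h := by
  rintro y ⟨q, hq⟩
  by_contra hcon
  simp only [noncommuting, Set.mem_ofPred_eq, not_exists, not_not] at hcon
  apply hq
  have hmem : g⁻¹ * h⁻¹ ∈ invariance (fun p : Point H => p.1) :=
    (invariance _).mul_mem ((invariance _).inv_mem hg) ((invariance _).inv_mem hh)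
  obtain ⟨r, hr⟩ : ∃ r, (g⁻¹ * h⁻¹) (y, q) = (y, r) :=
    ⟨((g⁻¹ * h⁻¹) (y, q)).2, Prod.ext (hmem (y, q)) rfl⟩
  rw [commutatorElement_def, mul_assoc, Equiv.Perm.mul_apply, Equiv.Perm.mul_apply, hr, hcon r,
    ← hr, ← Equiv.Perm.mul_apply, ← Equiv.Perm.mul_apply]
  simp

theorem mem_support_conj {σ : Equiv.Perm (ℚ × ℚ)} {s : Equiv.Perm (Point H)} {y}
    (h : y ∈ support (movePosition σ * s * (movePosition σ)⁻¹)) : σ⁻¹ y ∈ support s := by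
  obtain ⟨q, hq⟩ := h
  refine ⟨q, fun h' => hq ?_⟩
  rw [Equiv.Perm.mul_apply, Equiv.Perm.mul_apply, ← map_inv, movePosition_apply (σ⁻¹), h',
    movePosition_apply]
  exact Prod.ext (σ.apply_symm_apply y) rfl

theorem support_shiftPerm_subset : support (shiftPerm H) ⊆ {0} := by
  rintro y ⟨⟨i, x, e⟩, hq⟩
  by_contra hy
  exact hq (by simp [shiftPerm_apply, show y ≠ 0 from hy])

/-! ### Skew products and normality of the kernels -/

variable [Group H]

/-- Permutations of `Point H` that are skew products over a homothety, with level shifts bounded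
by `R` and multipliers trivial below level `-R` and constant from level `R` on. -/
def IsSkew (g : Equiv.Perm (Point H)) : Prop :=
  ∃ σ ∈ homotheties, ∃ (k : ℚ × ℚ → ℤ) (f : ℚ × ℚ → ℤ → H) (c : ℚ × ℚ → ℤ → H → ℕ → ℤ) (R : ℕ),
    (∀ y i x e, g (y, i, x, e) = (σ y, i + k y, f y i * x, e + c y i x)) ∧
    (∀ y, |k y| ≤ R) ∧ (∀ y i, i < -(R : ℤ) → f y i = 1) ∧ ∀ y i, (R : ℤ) ≤ i → f y i = f y R

theorem IsSkew.one : IsSkew (1 : Equiv.Perm (Point H)) :=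
  ⟨1, homotheties.one_mem, 0, fun _ _ => 1, 0, 0, by simp⟩

theorem IsSkew.mul {g h : Equiv.Perm (Point H)} (hg : IsSkew g) (hh : IsSkew h) :
    IsSkew (g * h) := by
  obtain ⟨σ, hσ, k, f, c, R, h1, h2, h3, h4⟩ := hg
  obtain ⟨σ', hσ', k', f', c', R', h1', h2', h3', h4'⟩ := hh
  refine ⟨σ * σ', homotheties.mul_mem hσ hσ', fun y => k' y + k (σ' y),
    fun y i => f (σ' y) (i + k' y) * f' y i,
    fun y i x => c' y i x + c (σ' y) (i + k' y) (f' y i * x), R + R', ?_, ?_, ?_, ?_⟩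
  · intro y i x e
    simp only [Equiv.Perm.mul_apply, h1', h1, mul_assoc, add_assoc]
  · intro y
    have := abs_add_le (k' y) (k (σ' y))
    have a1 := h2' y
    have a2 := h2 (σ' y)
    push_cast
    linarith
  · intro y i hi
    have a1 := abs_le.1 (h2' y)
    push_cast at hi
    beta_reduce
    rw [h3 _ _ (by omega), h3' _ _ (by omega), one_mul]
  · intro y i hi
    have a1 := abs_le.1 (h2' y)
    push_cast at hi ⊢
    rw [h4 _ (i + k' y) (by omega), h4' _ i (by omega), h4 _ (R + R' + k' y) (by omega),
      h4' _ (R + R') (by omega)]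

theorem isSkew_movePosition {σ : Equiv.Perm (ℚ × ℚ)} (hσ : σ ∈ homotheties) :
    IsSkew (movePosition σ : Equiv.Perm (Point H)) :=
  ⟨σ, hσ, 0, fun _ _ => 1, 0, 0, by simp⟩

theorem isSkew_stepPerm (γ : ℚ × ℚ → H) (F : H → ℕ → ℤ) : IsSkew (stepPerm γ F) := by
  refine ⟨1, homotheties.one_mem, 0, fun y i => if 0 ≤ i then γ y else 1,
    fun y i x => if 0 ≤ i then 0 else F x - F (γ y * x), 0, ?_, by simp, ?_, ?_⟩
  · intro y i x e
    rw [stepPerm_apply]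
    by_cases hi : 0 ≤ i <;> simp [hi]
  · intro y i hi
    simp only [Nat.cast_zero, neg_zero] at hi
    simp [not_le.2 hi]
  · intro y i hi
    simp only [Nat.cast_zero] at hi
    simp [hi]

theorem isSkew_stepPerm_inv (γ : ℚ × ℚ → H) (F : H → ℕ → ℤ) : IsSkew (stepPerm γ F)⁻¹ := by
  refine ⟨1, homotheties.one_mem, 0, fun y i => if 0 ≤ i then (γ y)⁻¹ else 1,
    fun y i x => if 0 ≤ i then 0 else -(F x - F (γ y * x)), 0, ?_, by simp, ?_, ?_⟩
  · intro y i x e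
    rw [stepPerm_inv_apply]
    by_cases hi : 0 ≤ i <;> simp [hi, sub_eq_add_neg]
  · intro y i hi
    simp only [Nat.cast_zero, neg_zero] at hi
    simp [not_le.2 hi]
  · intro y i hi
    simp only [Nat.cast_zero] at hi
    simp [hi]

theorem isSkew_shiftPerm : IsSkew (shiftPerm H) :=
  ⟨1, homotheties.one_mem, fun y => if y = 0 then 1 else 0, fun _ _ => 1, 0, 1,
    by simp [shiftPerm_apply], fun y => by by_cases hy : y = 0 <;> simp [hy], by simp, by simp⟩

theorem isSkew_shiftPerm_inv : IsSkew (shiftPerm H)⁻¹ :=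
  ⟨1, homotheties.one_mem, fun y => -if y = 0 then 1 else 0, fun _ _ => 1, 0, 1,
    by simp [shiftPerm_inv_apply, sub_eq_add_neg],
    fun y => by by_cases hy : y = 0 <;> simp [hy], by simp, by simp⟩

/-- The generators of the ambient group. -/
def generators (γ : ℚ × ℚ → H) (F : H → ℕ → ℤ) : Set (Equiv.Perm (Point H)) :=
  {movePosition (Equiv.addRight (1, 0)), movePosition (Equiv.addRight (0, 1)),
    movePosition double, stepPerm γ F, shiftPerm H}

theorem isSkew_of_mem_closure {γ : ℚ × ℚ → H} {F : H → ℕ → ℤ} {g : Equiv.Perm (Point H)}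
    (hg : g ∈ Subgroup.closure (generators γ F)) : IsSkew g := by
  have key : ∀ x ∈ generators γ F, IsSkew x ∧ IsSkew x⁻¹ := by
    have hm : ∀ σ ∈ homotheties, IsSkew (movePosition σ : Equiv.Perm (Point H)) ∧
        IsSkew (movePosition σ : Equiv.Perm (Point H))⁻¹ := fun σ hσ =>
      ⟨isSkew_movePosition hσ, by
        rw [← map_inv]; exact isSkew_movePosition (homotheties.inv_mem hσ)⟩
    rintro x (rfl | rfl | rfl | rfl | rfl)
    · exact hm _ (addRight_mem_homotheties _)
    · exact hm _ (addRight_mem_homotheties _)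
    · exact hm _ double_mem_homotheties
    · exact ⟨isSkew_stepPerm _ _, isSkew_stepPerm_inv _ _⟩
    · exact ⟨isSkew_shiftPerm, isSkew_shiftPerm_inv⟩
  induction hg using Subgroup.closure_induction_left with
  | one => exact IsSkew.one
  | mul_left x hx y _ hy => exact (key x hx).1.mul hy
  | inv_mul_cancel x hx y _ hy => exact (key x hx).2.mul hy

theorem IsSkew.conj_mem_finitary {g n : Equiv.Perm (Point H)} (hg : IsSkew g)
    (hn : n ∈ finitary H) : g * n * g⁻¹ ∈ finitary H := by
  obtain ⟨σ, hσ, k, f, c, R, h, -⟩ := hg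
  obtain ⟨hn, hfin⟩ := hn
  have hσ' : ∀ p : Point H, (g p).1 = σ p.1 := fun ⟨y, i, x, e⟩ => by rw [h]
  refine ⟨conj_mem_invariance fun p => ?_, (hfin.image σ).subset ?_⟩
  · rw [hσ', hσ', mem_invariance.1 hn p]
  · rintro y ⟨q, hq⟩
    obtain ⟨⟨z, r⟩, hz⟩ := g.surjective (y, q)
    rw [← hz, Equiv.Perm.mul_apply, Equiv.Perm.mul_apply,
      show g⁻¹ (g (z, r)) = (z, r) from g.symm_apply_apply _] at hq
    refine ⟨z, ⟨r, fun h' => hq (by rw [h'])⟩, ?_⟩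
    rw [← hσ' (z, r), hz]

theorem IsSkew.conj_mem_levelKernel {g n : Equiv.Perm (Point H)} (hg : IsSkew g)
    (hn : n ∈ levelKernel H) : g * n * g⁻¹ ∈ levelKernel H := by
  refine ⟨hg.conj_mem_finitary hn.1, conj_mem_invariance ?_⟩
  obtain ⟨σ, hσ, k, f, c, R, h, -⟩ := hg
  have h' : ∀ p : Point H, (g p).2.1 = p.2.1 + k p.1 := fun ⟨y, i, x, e⟩ => by rw [h]
  intro p
  have h1 := hn.1.1 p
  have h2 := hn.2 p
  simp only at h1 h2
  simp only [h', h1, h2]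

/-- A skew product acts on the value by a factor depending only on position and level, which `n`
preserves; the counter plays no role. -/
theorem IsSkew.conj_mem_valueKernel {g n : Equiv.Perm (Point H)} (hg : IsSkew g)
    (hn : n ∈ valueKernel H) : g * n * g⁻¹ ∈ valueKernel H := by
  refine ⟨hg.conj_mem_levelKernel hn.1, conj_mem_invariance ?_⟩
  obtain ⟨σ, hσ, k, f, c, R, h, -⟩ := hg
  have h' : ∀ p : Point H, (g p).2.2.1 = f p.1 p.2.1 * p.2.2.1 :=
    fun ⟨y, i, x, e⟩ => by rw [h]
  intro p
  have h1 := hn.1.1.1 p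
  have h2 := hn.1.2 p
  have h3 := hn.2 p
  simp only at h1 h2 h3
  simp only [h', h1, h2, h3]

/-- Both elements add to the counter an amount that depends only on the coordinates they fix. -/
theorem IsSkew.commute_of_mem_valueKernel {g h : Equiv.Perm (Point H)} (hg : IsSkew g)
    (hh : IsSkew h) (hg' : g ∈ valueKernel H) (hh' : h ∈ valueKernel H) : g * h = h * g := by
  have key : ∀ g : Equiv.Perm (Point H), IsSkew g → g ∈ valueKernel H →
      ∃ c : ℚ × ℚ → ℤ → H → ℕ → ℤ, ∀ y i x e, g (y, i, x, e) = (y, i, x, e + c y i x) := by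
    rintro g ⟨σ, hσ, k, f, c, R, h, -⟩ hk
    refine ⟨c, fun y i x e => ?_⟩
    have h1 := hk.1.1.1 (y, i, x, e)
    have h2 := hk.1.2 (y, i, x, e)
    have h3 := hk.2 (y, i, x, e)
    simp only [h] at h1 h2 h3
    rw [h, h1, h2, h3]
  obtain ⟨c, hc⟩ := key g hg hg'
  obtain ⟨d, hd⟩ := key h hh hh'
  ext1 ⟨y, i, x, e⟩
  simp only [Equiv.Perm.mul_apply, hc, hd, add_right_comm]

/-! ### Commuting over all but finitely many positions -/

/-- The conjugates of `stepPerm γ F` and `shiftPerm H` by homotheties. -/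
def conjugates (γ : ℚ × ℚ → H) (F : H → ℕ → ℤ) : Set (Equiv.Perm (Point H)) :=
  {g | ∃ σ ∈ homotheties, ∃ s ∈ ({stepPerm γ F, shiftPerm H} : Set (Equiv.Perm (Point H))),
    g = movePosition σ * s * (movePosition σ)⁻¹}

theorem conjugates_subset_invariance (γ : ℚ × ℚ → H) (F : H → ℕ → ℤ) :
    conjugates γ F ⊆ invariance (fun p : Point H => p.1) := by
  rintro _ ⟨σ, hσ, s, (rfl | rfl), rfl⟩ <;> exact conj_mem_invariance fun p => rfl

theorem closure_conjugates_le_invariance (γ : ℚ × ℚ → H) (F : H → ℕ → ℤ) :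
    Subgroup.closure (conjugates γ F) ≤ invariance (fun p : Point H => p.1) :=
  (Subgroup.closure_le _).2 (conjugates_subset_invariance γ F)

theorem support_stepPerm_subset {γ : ℚ × ℚ → H} (hγ : ∀ y, γ y ≠ 1 → y ∈ parabola)
    (F : H → ℕ → ℤ) : support (stepPerm γ F) ⊆ parabola := by
  rintro y ⟨⟨i, x, e⟩, hq⟩
  refine hγ y fun h => hq ?_
  simp [stepPerm_apply, h]

/-- Elements fixing positions can fail to commute only over common support. A shift conjugate lives
over one position, and step conjugates live over homothetic parabolas, which meet finitely unless
the two conjugates coincide. -/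
theorem finite_noncommuting_conjugates {γ : ℚ × ℚ → H} (hγ : ∀ y, γ y ≠ 1 → y ∈ parabola)
    {F : H → ℕ → ℤ} {g h : Equiv.Perm (Point H)} (hg : g ∈ conjugates γ F)
    (hh : h ∈ conjugates γ F) : (noncommuting g h).Finite := by
  have hsub := noncommuting_subset_inter_support (conjugates_subset_invariance γ F hg)
    (conjugates_subset_invariance γ F hh)
  have hshift : ∀ σ : Equiv.Perm (ℚ × ℚ),
      (support (movePosition σ * shiftPerm H * (movePosition σ)⁻¹)).Finite := by
    refine fun σ => (Set.finite_singleton (σ 0)).subset fun y hy => ?_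
    have := support_shiftPerm_subset (mem_support_conj hy)
    rw [Set.mem_singleton_iff, Equiv.Perm.inv_eq_iff_eq] at this
    exact this
  obtain ⟨σ, hσ, s, (rfl | rfl), rfl⟩ := hg
  · obtain ⟨τ, hτ, t, (rfl | rfl), rfl⟩ := hh
    · by_cases hne : σ = τ
      · subst hne
        simp [noncommuting]
      · refine (finite_image_parabola_inter hσ hτ hne).subset fun y hy => ?_
        exact ⟨support_stepPerm_subset hγ F (mem_support_conj (hsub hy).1),
          support_stepPerm_subset hγ F (mem_support_conj (hsub hy).2)⟩
    · exact (hshift τ).subset fun y hy => (hsub hy).2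
  · exact (hshift σ).subset fun y hy => (hsub hy).1

theorem finite_noncommuting_closure {γ : ℚ × ℚ → H} (hγ : ∀ y, γ y ≠ 1 → y ∈ parabola)
    {F : H → ℕ → ℤ} {g h : Equiv.Perm (Point H)}
    (hg : g ∈ Subgroup.closure (conjugates γ F))
    (hh : h ∈ Subgroup.closure (conjugates γ F)) : (noncommuting g h).Finite := by
  have aux : ∀ h : Equiv.Perm (Point H), (∀ s ∈ conjugates γ F, (noncommuting s h).Finite) →
      ∀ g ∈ Subgroup.closure (conjugates γ F), (noncommuting g h).Finite := by
    intro h hs g hg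
    induction hg using Subgroup.closure_induction with
    | mem s hs' => exact hs s hs'
    | one => simp [noncommuting]
    | mul a b _ hb iha ihb =>
      exact (iha.union ihb).subset
        (noncommuting_mul_subset (closure_conjugates_le_invariance γ F hb))
    | inv a ha iha =>
      exact iha.subset (noncommuting_inv_subset (closure_conjugates_le_invariance γ F ha))
  refine aux h (fun s hs => ?_) g hg
  rw [noncommuting_symm]
  refine aux s (fun t ht => finite_noncommuting_conjugates hγ ht hs) h hh

theorem movePosition_conj_mem_closure {γ : ℚ × ℚ → H} {F : H → ℕ → ℤ}
    {σ : Equiv.Perm (ℚ × ℚ)} (hσ : σ ∈ homotheties) {n : Equiv.Perm (Point H)}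
    (hn : n ∈ Subgroup.closure (conjugates γ F)) :
    movePosition σ * n * (movePosition σ)⁻¹ ∈ Subgroup.closure (conjugates γ F) := by
  induction hn using Subgroup.closure_induction with
  | mem s hs =>
    obtain ⟨τ, hτ, s, hs, rfl⟩ := hs
    exact Subgroup.subset_closure ⟨σ * τ, homotheties.mul_mem hσ hτ, s, hs, by
      rw [map_mul]; group⟩
  | one => simp
  | mul a b _ _ iha ihb => simpa [mul_assoc] using Subgroup.mul_mem _ iha ihb
  | inv a _ iha => simpa [mul_assoc] using Subgroup.inv_mem _ iha

/-- The closure of the conjugates is normalized by homotheties, so these can be collected on the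
right. -/
theorem exists_eq_mul_movePosition {γ : ℚ × ℚ → H} {F : H → ℕ → ℤ} {g : Equiv.Perm (Point H)}
    (hg : g ∈ Subgroup.closure (generators γ F)) :
    ∃ n ∈ Subgroup.closure (conjugates γ F), ∃ σ ∈ homotheties, g = n * movePosition σ := by
  have hmove : ∀ τ ∈ homotheties, ∀ h : Equiv.Perm (Point H),
      (∃ n ∈ Subgroup.closure (conjugates γ F), ∃ σ ∈ homotheties, h = n * movePosition σ) →
      ∃ n ∈ Subgroup.closure (conjugates γ F), ∃ σ ∈ homotheties,
        movePosition τ * h = n * movePosition σ := by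
    rintro τ hτ _ ⟨n, hn, σ, hσ, rfl⟩
    exact ⟨_, movePosition_conj_mem_closure hτ hn, τ * σ, homotheties.mul_mem hτ hσ, by
      rw [map_mul]; group⟩
  have hconj : ∀ s ∈ Subgroup.closure (conjugates γ F), ∀ h : Equiv.Perm (Point H),
      (∃ n ∈ Subgroup.closure (conjugates γ F), ∃ σ ∈ homotheties, h = n * movePosition σ) →
      ∃ n ∈ Subgroup.closure (conjugates γ F), ∃ σ ∈ homotheties,
        s * h = n * movePosition σ := by
    rintro s hs _ ⟨n, hn, σ, hσ, rfl⟩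
    exact ⟨s * n, Subgroup.mul_mem _ hs hn, σ, hσ, (mul_assoc _ _ _).symm⟩
  have hmem : ∀ s ∈ ({stepPerm γ F, shiftPerm H} : Set (Equiv.Perm (Point H))),
      s ∈ Subgroup.closure (conjugates γ F) := fun s hs =>
    Subgroup.subset_closure ⟨1, homotheties.one_mem, s, hs, by simp⟩
  have key : ∀ x ∈ generators γ F, (∃ σ ∈ homotheties, x = movePosition σ) ∨
      x ∈ Subgroup.closure (conjugates γ F) := by
    rintro x (rfl | rfl | rfl | rfl | rfl)
    · exact Or.inl ⟨_, addRight_mem_homotheties _, rfl⟩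
    · exact Or.inl ⟨_, addRight_mem_homotheties _, rfl⟩
    · exact Or.inl ⟨_, double_mem_homotheties, rfl⟩
    · exact Or.inr (hmem _ (by simp))
    · exact Or.inr (hmem _ (by simp))
  induction hg using Subgroup.closure_induction_left with
  | one => exact ⟨1, Subgroup.one_mem _, 1, homotheties.one_mem, by simp⟩
  | mul_left x hx y _ hy =>
    rcases key x hx with ⟨σ, hσ, rfl⟩ | h
    · exact hmove σ hσ y hy
    · exact hconj x h y hy
  | inv_mul_cancel x hx y _ hy =>
    rcases key x hx with ⟨σ, hσ, rfl⟩ | h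
    · rw [← map_inv]
      exact hmove _ (homotheties.inv_mem hσ) y hy
    · exact hconj _ (Subgroup.inv_mem _ h) y hy

theorem mem_closure_conjugates {γ : ℚ × ℚ → H} {F : H → ℕ → ℤ} {g : Equiv.Perm (Point H)}
    (hg : g ∈ Subgroup.closure (generators γ F))
    (hfix : g ∈ invariance (fun p : Point H => p.1)) :
    g ∈ Subgroup.closure (conjugates γ F) := by
  obtain ⟨n, hn, σ, hσ, rfl⟩ := exists_eq_mul_movePosition hg
  have : σ = 1 := by
    ext1 y
    have h := hfix (y, 0, 1, 0)
    rw [Equiv.Perm.mul_apply, movePosition_apply] at h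
    have h' := closure_conjugates_le_invariance γ F hn (σ y, 0, 1, 0)
    exact h'.symm.trans h
  rw [this]
  simpa using hn

/-- Finiteness of the support is the parabola argument; levels are preserved because shifts by
integers depending only on the position commute. -/
theorem commutator_mem_levelKernel {γ : ℚ × ℚ → H} (hγ : ∀ y, γ y ≠ 1 → y ∈ parabola)
    {F : H → ℕ → ℤ} {g h : Equiv.Perm (Point H)}
    (hg : g ∈ Subgroup.closure (generators γ F)) (hh : h ∈ Subgroup.closure (generators γ F))
    (hg' : g ∈ invariance (fun p : Point H => p.1))
    (hh' : h ∈ invariance (fun p : Point H => p.1)) : ⁅g, h⁆ ∈ levelKernel H := by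
  refine ⟨⟨?_, ?_⟩, ?_⟩
  · exact Subgroup.mul_mem _ (Subgroup.mul_mem _ (Subgroup.mul_mem _ hg' hh')
      (Subgroup.inv_mem _ hg')) (Subgroup.inv_mem _ hh')
  · exact (finite_noncommuting_closure hγ (mem_closure_conjugates hg hg')
      (mem_closure_conjugates hh hh')).subset (support_commutator_subset hg' hh')
  · have key : ∀ g : Equiv.Perm (Point H), IsSkew g →
        g ∈ invariance (fun p : Point H => p.1) →
        ∃ k : ℚ × ℚ → ℤ, ∀ p : Point H, (g p).1 = p.1 ∧ (g p).2.1 = p.2.1 + k p.1 := by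
      rintro g ⟨σ, hσ, k, f, c, R, h, -⟩ hfix
      exact ⟨k, fun p => ⟨hfix p, by rw [h]⟩⟩
    obtain ⟨k, hk⟩ := key g (isSkew_of_mem_closure hg) hg'
    obtain ⟨l, hl⟩ := key h (isSkew_of_mem_closure hh) hh'
    have heq : ⁅g, h⁆ = (g * h) * (h * g)⁻¹ := by
      rw [commutatorElement_def]; group
    intro p
    obtain ⟨q, rfl⟩ := (h * g).surjective p
    rw [heq, Equiv.Perm.mul_apply,
      show (h * g)⁻¹ ((h * g) q) = q from (h * g).symm_apply_apply q]
    simp only [Equiv.Perm.mul_apply, hk, hl]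
    ring

end SkewEmbedding

/-! ### Solvability of the top quotient -/

namespace SkewEmbedding

open scoped commutatorElement

/-- The permutations that translate positions. -/
def translating (H : Type u) : Subgroup (Equiv.Perm (Point H)) where
  carrier := {g | ∃ w : ℚ × ℚ, ∀ p : Point H, (g p).1 = p.1 + w}
  mul_mem' := by
    rintro g h ⟨w, hg⟩ ⟨w', hh⟩
    exact ⟨w' + w, fun p => by rw [Equiv.Perm.mul_apply, hg, hh, add_assoc]⟩
  one_mem' := ⟨0, by simp⟩
  inv_mem' := by
    rintro g ⟨w, hg⟩
    refine ⟨-w, fun p => ?_⟩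
    have h := hg (g⁻¹ p)
    rw [show g (g⁻¹ p) = p from g.apply_symm_apply p] at h
    rw [h, add_neg_cancel_right]

theorem commutatorElement_apply_mul {α : Type*} (g h : Equiv.Perm α) (a : α) :
    ⁅g, h⁆ (h (g a)) = g (h a) := by
  simp [commutatorElement_def]

variable {H : Type u}

theorem commutator_mem_invariance_of_translating {g h : Equiv.Perm (Point H)}
    (hg : g ∈ translating H) (hh : h ∈ translating H) :
    ⁅g, h⁆ ∈ invariance (fun p : Point H => p.1) := by
  obtain ⟨w, hg⟩ := hg
  obtain ⟨w', hh⟩ := hh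
  intro p
  obtain ⟨q, rfl⟩ := (h * g).surjective p
  beta_reduce
  rw [Equiv.Perm.mul_apply, commutatorElement_apply_mul, hg, hh, hh, hg, add_right_comm]

variable [Group H]

theorem IsSkew.commutator_mem_translating {g h : Equiv.Perm (Point H)} (hg : IsSkew g)
    (hh : IsSkew h) : ⁅g, h⁆ ∈ translating H := by
  obtain ⟨σ, ⟨c, hc, w, hσ⟩, k, f, e, R, hg, -⟩ := hg
  obtain ⟨σ', ⟨c', hc', w', hσ'⟩, k', f', e', R', hh, -⟩ := hh
  have hg' : ∀ p : Point H, (g p).1 = c • p.1 + w := fun ⟨y, i, x, e⟩ => by rw [hg, hσ]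
  have hh' : ∀ p : Point H, (h p).1 = c' • p.1 + w' := fun ⟨y, i, x, e⟩ => by rw [hh, hσ']
  refine ⟨c • w' + w - c' • w - w', fun p => ?_⟩
  obtain ⟨q, rfl⟩ := (h * g).surjective p
  rw [Equiv.Perm.mul_apply, commutatorElement_apply_mul, hg', hh', hh', hg', smul_add, smul_add,
    smul_smul, smul_smul, mul_comm c c']
  abel

/-- Scalar linear parts commute, then translations commute, then elements fixing positions commute
up to `levelKernel`. -/
theorem derivedSeries_three_le {γ : ℚ × ℚ → H} (hγ : ∀ y, γ y ≠ 1 → y ∈ parabola)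
    (F : H → ℕ → ℤ) : derivedSeries (Subgroup.closure (generators γ F)) 3 ≤
      (levelKernel H).subgroupOf (Subgroup.closure (generators γ F)) := by
  set G := Subgroup.closure (generators γ F)
  have h1 : derivedSeries G 1 ≤ (translating H).subgroupOf G := by
    rw [derivedSeries_succ, Subgroup.commutator_le]
    intro g _ h _
    exact (isSkew_of_mem_closure g.2).commutator_mem_translating (isSkew_of_mem_closure h.2)
  have h2 : derivedSeries G 2 ≤ (invariance (fun p : Point H => p.1)).subgroupOf G := by
    rw [derivedSeries_succ, Subgroup.commutator_le]
    intro g hg h hh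
    exact commutator_mem_invariance_of_translating (h1 hg) (h1 hh)
  rw [derivedSeries_succ, Subgroup.commutator_le]
  intro g hg h hh
  exact commutator_mem_levelKernel hγ g.2 h.2 (h2 hg) (h2 hh)

theorem derivedSeries_quotient_eq_bot {G : Type*} [Group G] {N : Subgroup G} [N.Normal] {n : ℕ}
    (h : derivedSeries G n ≤ N) : derivedSeries (G ⧸ N) n = ⊥ := by
  rw [← map_derivedSeries_eq (QuotientGroup.mk'_surjective N), Subgroup.map_eq_bot_iff,
    QuotientGroup.ker_mk']
  exact h

/-! ### Local embedding in powers of `H` -/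

/-- The subgroup `D` contains the image of everything generated by `S`, and restriction to the
finite set `J` is injective on `D`. -/
theorem locallyEmbedsInPowers_of_injective {K : Type v} [Group K] {I : Type*}
    (ψ : K →* (I → H)) (hψ : Function.Injective ψ)
    (hfin : ∀ S : Finset K, ∃ (J : Finset I) (D : Subgroup (I → H)), (∀ s ∈ S, ψ s ∈ D) ∧
      ∀ u ∈ D, (∀ j ∈ J, u j = 1) → u = 1) : LocallyEmbedsInPowers H K := by
  rintro L ⟨S, rfl⟩
  obtain ⟨J, D, hS, hD⟩ := hfin S
  have hL : ∀ x ∈ Subgroup.closure (S : Set K), ψ x ∈ D :=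
    fun x hx => (Subgroup.closure_le (D.comap ψ)).2 hS hx
  refine ⟨J.card, { toFun := fun x j => ψ x (J.equivFin.symm j), map_one' := ?_, map_mul' := ?_ },
    ?_⟩
  · ext; simp
  · intros; ext; simp
  · rw [injective_iff_map_eq_one]
    intro x hx
    have h1 : ψ x = 1 := hD _ (hL x x.2) fun j hj => by
      simpa using congrFun hx (J.equivFin ⟨j, hj⟩)
    exact Subtype.ext (hψ (h1.trans ψ.map_one.symm))

/-- Functions on positions and levels that are trivial outside the positions in `Y` and below level
`-R`, and constant from level `R` on. -/
def stepFunctions (H : Type u) [Group H] (R : ℕ) (Y : Finset (ℚ × ℚ)) :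
    Subgroup ((ℚ × ℚ) × ℤ → H) where
  carrier := {u | (∀ y ∉ Y, ∀ i, u (y, i) = 1) ∧ (∀ y i, i < -(R : ℤ) → u (y, i) = 1) ∧
    ∀ y i, (R : ℤ) ≤ i → u (y, i) = u (y, R)}
  mul_mem' := by
    rintro a b ⟨ha1, ha2, ha3⟩ ⟨hb1, hb2, hb3⟩
    exact ⟨fun y hy i => by simp [ha1 y hy, hb1 y hy],
      fun y i hi => by simp [ha2 y i hi, hb2 y i hi],
      fun y i hi => by rw [Pi.mul_apply, Pi.mul_apply, ha3 y i hi, hb3 y i hi]⟩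
  one_mem' := by simp
  inv_mem' := by
    rintro a ⟨ha1, ha2, ha3⟩
    exact ⟨fun y hy i => by simp [ha1 y hy], fun y i hi => by simp [ha2 y i hi],
      fun y i hi => by rw [Pi.inv_apply, Pi.inv_apply, ha3 y i hi]⟩

theorem stepFunctions_mono {R R' : ℕ} {Y Y' : Finset (ℚ × ℚ)} (hR : R ≤ R') (hY : Y ⊆ Y') :
    stepFunctions H R Y ≤ stepFunctions H R' Y' := by
  rintro u ⟨h1, h2, h3⟩
  exact ⟨fun y hy i => h1 y (fun h => hy (hY h)) i, fun y i hi => h2 y i (by omega),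
    fun y i hi => by rw [h3 y i (by omega), h3 y R' (by omega)]⟩

theorem eq_one_of_mem_stepFunctions {R : ℕ} {Y : Finset (ℚ × ℚ)} {u : (ℚ × ℚ) × ℤ → H}
    (hu : u ∈ stepFunctions H R Y)
    (h : ∀ j ∈ Y ×ˢ Finset.Icc (-(R : ℤ)) R, u j = 1) : u = 1 := by
  obtain ⟨h1, h2, h3⟩ := hu
  funext ⟨y, i⟩
  by_cases hy : y ∈ Y
  · rcases lt_or_ge i (-(R : ℤ)) with hi | hi
    · exact h2 y i hi
    rcases lt_or_ge (R : ℤ) i with hi' | hi'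
    · rw [h3 y i hi'.le]
      exact h _ (by simp [hy])
    · exact h _ (by simp [hy, hi, hi'])
  · exact h1 y hy i

/-- The multiplier of a permutation as a function of positions and levels. -/
def multiplier (g : Equiv.Perm (Point H)) : (ℚ × ℚ) × ℤ → H :=
  fun j => (g (j.1, j.2, 1, 0)).2.2.1

theorem IsSkew.value_apply {g : Equiv.Perm (Point H)} (hg : IsSkew g) (p : Point H) :
    (g p).2.2.1 = multiplier g (p.1, p.2.1) * p.2.2.1 := by
  obtain ⟨σ, hσ, k, f, c, R, h, -⟩ := hg
  obtain ⟨y, i, x, e⟩ := p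
  simp [multiplier, h]

theorem IsSkew.exists_multiplier_mem {g : Equiv.Perm (Point H)} (hg : IsSkew g)
    (hk : g ∈ levelKernel H) : ∃ R Y, multiplier g ∈ stepFunctions H R Y := by
  obtain ⟨σ, hσ, k, f, c, R, h, -, h3, h4⟩ := hg
  refine ⟨R, hk.1.2.toFinset, fun y hy i => ?_, fun y i hi => ?_, fun y i hi => ?_⟩
  · rw [Set.Finite.mem_toFinset] at hy
    rw [multiplier, apply_eq_of_notMem_support hy]
  · simp [multiplier, h, h3 y i hi]
  · simp only [multiplier, h, h4 y i hi]

/-- In general multipliers obey a cocycle rule; it reduces to a pointwise product because `h`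
preserves position and level. -/
theorem IsSkew.multiplier_mul {g h : Equiv.Perm (Point H)} (hg : IsSkew g)
    (hk : h ∈ levelKernel H) : multiplier (g * h) = multiplier g * multiplier h := by
  funext ⟨y, i⟩
  have h1 := hk.1.1 (y, i, 1, 0)
  have h2 := hk.2 (y, i, 1, 0)
  simp only at h1 h2
  rw [multiplier, Equiv.Perm.mul_apply, hg.value_apply, h1, h2]
  rfl

theorem locallyEmbedsInPowers_levelKernel (γ : ℚ × ℚ → H) (F : H → ℕ → ℤ)
    {G₁ G₂ : Subgroup (Subgroup.closure (generators γ F))}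
    (h₁ : G₁ = (valueKernel H).subgroupOf _) (h₂ : G₂ = (levelKernel H).subgroupOf _)
    [(G₁.subgroupOf G₂).Normal] :
    LocallyEmbedsInPowers H (G₂ ⧸ G₁.subgroupOf G₂) := by
  subst h₁ h₂
  let ψ : (levelKernel H).subgroupOf (Subgroup.closure (generators γ F)) →*
      ((ℚ × ℚ) × ℤ → H) :=
    { toFun := fun g => multiplier g.1.1
      map_one' := rfl
      map_mul' := fun g h => (isSkew_of_mem_closure g.1.2).multiplier_mul h.2 }
  have hker : ∀ g, ψ g = 1 ↔ g ∈ ((valueKernel H).subgroupOf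
      (Subgroup.closure (generators γ F))).subgroupOf ((levelKernel H).subgroupOf _) := by
    intro g
    rw [Subgroup.mem_subgroupOf, Subgroup.mem_subgroupOf]
    constructor
    · intro h
      refine ⟨g.2, fun p => ?_⟩
      have h' : multiplier g.1.1 = 1 := h
      simp only
      rw [(isSkew_of_mem_closure g.1.2).value_apply, h', Pi.one_apply, one_mul]
    · intro h
      funext j
      exact h.2 (j.1, j.2, 1, 0)
  refine locallyEmbedsInPowers_of_injective
    (QuotientGroup.lift _ ψ fun g hg => (hker g).2 hg) ?_ ?_
  · rw [injective_iff_map_eq_one]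
    intro q
    induction q using QuotientGroup.induction_on with
    | H g =>
      intro h
      exact (QuotientGroup.eq_one_iff g).2 ((hker g).1 h)
  · intro S
    have hmem : ∀ q, ∃ R Y, QuotientGroup.lift _ ψ (fun g hg => (hker g).2 hg) q ∈
        stepFunctions H R Y := by
      intro q
      induction q using QuotientGroup.induction_on with
      | H g => exact (isSkew_of_mem_closure g.1.2).exists_multiplier_mem g.2
    choose R Y hRY using hmem
    -- Enlarging the level bound and the set of positions puts all generators in one group of step
    -- functions, whose elements are determined on a finite box.
    refine ⟨_, stepFunctions H (S.sup R) (S.biUnion Y), fun s hs => ?_,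
      fun u hu => eq_one_of_mem_stepFunctions hu⟩
    exact stepFunctions_mono (Finset.le_sup hs) (Finset.subset_biUnion_of_mem Y hs) (hRY s)

end SkewEmbedding

namespace SkewEmbedding

/-- `g` is represented by a word of length at most `n` in the letters `X` and their inverses. -/
def HasWord {G : Type u} [Group G] (X : Set G) (g : G) (n : ℕ) : Prop :=
  ∃ w : List G, (∀ x ∈ w, x ∈ X ∨ x⁻¹ ∈ X) ∧ w.prod = g ∧ w.length ≤ n

/-! ### Word length -/

section Words

variable {G : Type u} [Group G] {X : Set G} {g h : G} {m n : ℕ}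

theorem HasWord.of_mem (hg : g ∈ X) : HasWord X g 1 :=
  ⟨[g], by simpa using Or.inl hg, by simp, by simp⟩

theorem HasWord.one : HasWord X 1 0 := ⟨[], by simp, by simp, by simp⟩

theorem HasWord.mono (hg : HasWord X g m) (hmn : m ≤ n) : HasWord X g n := by
  obtain ⟨w, h1, h2, h3⟩ := hg
  exact ⟨w, h1, h2, h3.trans hmn⟩

theorem HasWord.mul (hg : HasWord X g m) (hh : HasWord X h n) : HasWord X (g * h) (m + n) := by
  obtain ⟨w, h1, rfl, h3⟩ := hg
  obtain ⟨w', h1', rfl, h3'⟩ := hh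
  refine ⟨w ++ w', fun x hx => ?_, by simp, by rw [List.length_append]; omega⟩
  rcases List.mem_append.1 hx with hx | hx
  exacts [h1 x hx, h1' x hx]

theorem HasWord.inv (hg : HasWord X g m) : HasWord X g⁻¹ m := by
  obtain ⟨w, h1, rfl, h3⟩ := hg
  refine ⟨(w.map (·⁻¹)).reverse, fun x hx => ?_, (List.prod_inv_reverse w).symm, by simpa⟩
  simp only [List.mem_reverse, List.mem_map] at hx
  obtain ⟨y, hy, rfl⟩ := hx
  rw [inv_inv]
  exact (h1 y hy).symm

theorem HasWord.wordLength_le (hg : HasWord X g n) : wordLength X g ≤ n := by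
  obtain ⟨w, h1, h2, h3⟩ := hg
  refine le_trans (Nat.sInf_le ?_) h3
  exact ⟨w, h1, h2, rfl⟩

theorem exists_hasWord_of_mem_closure (hg : g ∈ Subgroup.closure X) : ∃ n, HasWord X g n := by
  induction hg using Subgroup.closure_induction with
  | mem x hx => exact ⟨1, HasWord.of_mem hx⟩
  | one => exact ⟨0, HasWord.one⟩
  | mul x y _ _ hx hy => exact ⟨_, hx.choose_spec.mul hy.choose_spec⟩
  | inv x _ hx => exact ⟨_, hx.choose_spec.inv⟩

theorem exists_word_of_closure_eq_top (hX : Subgroup.closure X = ⊤) (g : G) :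
    ∃ w : List G, (∀ x ∈ w, x ∈ X ∨ x⁻¹ ∈ X) ∧ w.prod = g ∧ w.length = wordLength X g := by
  obtain ⟨_, w, h1, h2, -⟩ := exists_hasWord_of_mem_closure
    (show g ∈ Subgroup.closure X by rw [hX]; trivial)
  exact Nat.sInf_mem (s := {n : ℕ | ∃ w : List G, (∀ x ∈ w, x ∈ X ∨ x⁻¹ ∈ X) ∧ w.prod = g ∧
    w.length = n}) ⟨w.length, w, h1, h2, rfl⟩

/-- Words in the generators of a subgroup can be read inside the subgroup. -/
theorem HasWord.subtype (hg : HasWord X g n) (hmem : g ∈ Subgroup.closure X) :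
    HasWord (Subtype.val ⁻¹' X : Set (Subgroup.closure X)) ⟨g, hmem⟩ n := by
  obtain ⟨w, h1, rfl, h3⟩ := hg
  have hw : ∀ x ∈ w, x ∈ Subgroup.closure X := fun x hx => by
    rcases h1 x hx with h | h
    · exact Subgroup.subset_closure h
    · exact (Subgroup.inv_mem_iff _).1 (Subgroup.subset_closure h)
  lift w to List (Subgroup.closure X) using hw
  refine ⟨w, fun x hx => ?_, ?_, by simpa using h3⟩
  · exact h1 x (List.mem_map_of_mem hx)
  · exact Subtype.ext (by simp)

end Words

/-! ### Numbering a group of exponential growth -/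

section Indexing

theorem exists_sphere_numbering {H : Type u} [Group H] {ℓ : H → ℕ} (hℓ : IsLengthFunction ℓ)
    {D : ℕ} (hD : ∀ n : ℕ, 1 ≤ n →
      {h : H | ℓ h ≤ n}.Finite ∧ {h : H | ℓ h ≤ n}.ncard ≤ D ^ n) (n : ℕ) :
    ∃ f : H → ℕ, Set.InjOn f {h | ℓ h = n} ∧ ∀ h, ℓ h = n → f h < D ^ n := by
  rcases Nat.eq_zero_or_pos n with rfl | hn
  · refine ⟨fun _ => 0, fun g hg h hh _ => ?_, by simp⟩
    exact ((hℓ.eq_zero_iff g).1 hg).trans ((hℓ.eq_zero_iff h).1 hh).symm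
  · obtain ⟨hfin, hcard⟩ := hD n hn
    rw [Set.ncard_eq_toFinset_card _ hfin] at hcard
    classical
    refine ⟨fun h => if hh : h ∈ hfin.toFinset then (hfin.toFinset.equivFin ⟨h, hh⟩ : ℕ) else 0,
      fun g hg h hh hgh => ?_, fun h hh => ?_⟩
    · have hg' : g ∈ hfin.toFinset := by simpa using le_of_eq hg
      have hh' : h ∈ hfin.toFinset := by simpa using le_of_eq hh
      simp only [dif_pos hg', dif_pos hh'] at hgh
      simpa using hfin.toFinset.equivFin.injective (Fin.ext hgh)
    · have hh' : h ∈ hfin.toFinset := by simpa using hh.le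
      simp only [dif_pos hh']
      exact (Fin.is_lt _).trans_le hcard

/-- A group of at most exponential growth can be numbered so that the number of digits is
comparable with the length. -/
theorem exists_numbering {H : Type u} [Group H] {ℓ : H → ℕ} (hℓ : IsLengthFunction ℓ)
    (hexp : GrowthAtMostExponential ℓ) :
    ∃ (N : H → ℕ) (C : ℕ), Function.Injective N ∧ (∀ h, 4 ^ ℓ h ≤ N h) ∧
      ∀ h, h ≠ 1 → N h < 2 ^ (C * ℓ h) := by
  obtain ⟨a, ha⟩ := hexp
  -- The growth base is replaced by a power of two, at least 4 so that `4 ^ ℓ h ≤ N h`.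
  obtain ⟨k, hk, hk2⟩ : ∃ k : ℕ, |a| ≤ 2 ^ k ∧ 2 ≤ k := by
    obtain ⟨k, hk⟩ := pow_unbounded_of_one_lt |a| (one_lt_two : (1 : ℝ) < 2)
    exact ⟨k + 2, hk.le.trans (pow_le_pow_right₀ one_le_two (by omega)), by omega⟩
  have hD4 : 4 ≤ 2 ^ k := (show 4 = 2 ^ 2 from rfl) ▸ Nat.pow_le_pow_right two_pos hk2
  have hD : ∀ n : ℕ, 1 ≤ n →
      {h : H | ℓ h ≤ n}.Finite ∧ {h : H | ℓ h ≤ n}.ncard ≤ (2 ^ k) ^ n := by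
    intro n hn
    refine ⟨(ha n hn).1, ?_⟩
    have h1 : ({h : H | ℓ h ≤ n}.ncard : ℝ) ≤ (2 ^ k) ^ n :=
      ((ha n hn).2.trans (le_abs_self _)).trans (by
        rw [abs_pow]; exact pow_le_pow_left₀ (abs_nonneg a) hk n)
    exact_mod_cast h1
  choose f hf1 hf2 using exists_sphere_numbering hℓ hD
  have hpos : ∀ n, 0 < (2 ^ k) ^ n := fun n => by positivity
  have hlt : ∀ h, (2 ^ k) ^ ℓ h + f (ℓ h) h < 2 * (2 ^ k) ^ ℓ h := fun h => by
    have := hf2 (ℓ h) h rfl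
    omega
  have hlog : ∀ h, Nat.log (2 ^ k) ((2 ^ k) ^ ℓ h + f (ℓ h) h) = ℓ h := fun h =>
    Nat.log_eq_of_pow_le_of_lt_pow (Nat.le_add_right _ _) ((hlt h).trans_le (by
      rw [pow_succ, mul_comm]
      exact Nat.mul_le_mul_left _ (by omega)))
  -- The sphere of radius n is numbered inside `[D ^ n, 2 * D ^ n)` with `D = 2 ^ k`. These blocks
  -- are disjoint, so the base-`D` logarithm recovers the length. The extra 1 in `k + 1` absorbs the
  -- factor 2 once `ℓ h ≥ 1`.
  refine ⟨fun h => (2 ^ k) ^ ℓ h + f (ℓ h) h, k + 1, fun g h hgh => ?_, fun h => ?_,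
    fun h hh => ?_⟩
  · simp only at hgh
    have hl : ℓ g = ℓ h := by rw [← hlog g, hgh, hlog h]
    rw [hl] at hgh
    exact hf1 (ℓ h) hl rfl (Nat.add_left_cancel hgh)
  · exact (Nat.pow_le_pow_left hD4 _).trans (Nat.le_add_right _ _)
  · have hl : 1 ≤ ℓ h := Nat.one_le_iff_ne_zero.2 fun h0 => hh ((hℓ.eq_zero_iff h).1 h0)
    refine (hlt h).trans_le ?_
    rw [← pow_mul, ← pow_succ']
    exact Nat.pow_le_pow_right two_pos (by rw [add_mul]; omega)

end Indexing

/-! ### Lower bound for word length: the budget -/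

variable {H : Type u}

/-- The indicator functions of the balls of `ℓ`. -/
def ballIndicator (ℓ : H → ℕ) (x : H) : ℕ → ℤ := fun t => if ℓ x ≤ t then 1 else 0

/-- A bound, valid after `n` letters, on the set of places where the counter is nonzero: all but
`n - d` of these places are within `d / 2` of the length of the value, where `d` also bounds the
logarithm of the position; on nonnegative levels there are no others. -/
def Budget (ℓ : H → ℕ) (n : ℕ) (p : Point H) : Prop :=
  ∃ (d : ℕ) (T : Finset ℕ), T.card + d ≤ n ∧ |p.1.1| ≤ 2 ^ d - 1 ∧
    ∀ t, p.2.2.2 t ≠ 0 → t ∈ T ∨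
      (p.2.1 < 0 ∧ 2 * ℓ p.2.2.1 ≤ 2 * t + d ∧ 2 * t < 2 * ℓ p.2.2.1 + d)

/-- Raising `d` by one pays for the move: `2 ^ (d + 1) - 1` bounds both `(2 ^ d - 1) + 1` and `2 *
(2 ^ d - 1)`. -/
theorem Budget.movePosition {ℓ : H → ℕ} {n : ℕ} {p : Point H} (hp : Budget ℓ n p)
    {σ : Equiv.Perm (ℚ × ℚ)} (hσ : ∀ y, |(σ y).1| ≤ |y.1| + 1 ∨ |(σ y).1| ≤ 2 * |y.1|) :
    Budget ℓ (n + 1) (movePosition σ p) := by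
  obtain ⟨d, T, h1, h2, h3⟩ := hp
  refine ⟨d + 1, T, by omega, ?_, fun t ht => ?_⟩
  · have hd : (1 : ℚ) ≤ 2 ^ d := one_le_pow₀ one_le_two
    rw [movePosition_apply, pow_succ]
    rcases hσ p.1 with h | h <;> simp only <;> linarith
  · rcases h3 t ht with h | ⟨h4, h5, h6⟩
    · exact Or.inl h
    · exact Or.inr ⟨h4, by simp only [movePosition_apply]; omega,
        by simp only [movePosition_apply]; omega⟩

theorem Budget.changeLevel {ℓ : H → ℕ} {n : ℕ} {y : ℚ × ℚ} {i i' : ℤ} {x : H} {e : ℕ → ℤ}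
    (hp : Budget ℓ n (y, i, x, e)) (hi : y ≠ 0 → i' = i) : Budget ℓ (n + 1) (y, i', x, e) := by
  obtain ⟨d, T, h1, h2, h3⟩ := hp
  simp only at h2 h3
  by_cases hy : y = 0
  · classical
    -- The level can change only over the origin, where `d` may be reset to 0. The window around the
    -- length contains at most `d` places, so moving it into `T` uses exactly the allowance
    -- released. The endpoints are halves rounded up; truncation at 0 only shortens the interval.
    refine ⟨0, T ∪ Finset.Ico ((2 * ℓ x - d + 1) / 2) ((2 * ℓ x + d + 1) / 2), ?_, by simp [hy],
      fun t ht => ?_⟩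
    · have := Finset.card_union_le T (Finset.Ico ((2 * ℓ x - d + 1) / 2) ((2 * ℓ x + d + 1) / 2))
      rw [Nat.card_Ico] at this
      omega
    · rw [Finset.mem_union, Finset.mem_Ico]
      rcases h3 t ht with h | ⟨h4, h5, h6⟩
      · exact Or.inl (Or.inl h)
      · exact Or.inl (Or.inr ⟨by omega, by omega⟩)
  · refine ⟨d + 1, T, by omega, h2.trans ?_, fun t ht => ?_⟩
    · have hd : (0 : ℚ) < 2 ^ d := by positivity
      rw [pow_succ]
      linarith
    · rcases h3 t ht with h | ⟨h4, h5, h6⟩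
      · exact Or.inl h
      · exact Or.inr ⟨by rwa [hi hy], by simp only; omega, by simp only; omega⟩

variable [Group H]

/-- On negative levels the value stays put, so the window keeps its centre, and the changed places
lie between `ℓ x` and `ℓ (g * x)`. On nonnegative levels the counter is untouched and there is no
window to recentre. -/
theorem Budget.changeValue {ℓ : H → ℕ} (hℓ : IsLengthFunction ℓ) {n : ℕ} {y : ℚ × ℚ} {i : ℤ}
    {x x' : H} {e e' : ℕ → ℤ} (hp : Budget ℓ n (y, i, x, e)) {g : H}
    (hg : g ≠ 1 → (4 : ℚ) ^ ℓ g ≤ y.1) (hx : i < 0 → x' = x)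
    (he : ∀ t, e' t ≠ e t → i < 0 ∧ ballIndicator ℓ x t ≠ ballIndicator ℓ (g * x) t) :
    Budget ℓ (n + 1) (y, i, x', e') := by
  obtain ⟨d, T, h1, h2, h3⟩ := hp
  refine ⟨d + 1, T, by omega, h2.trans ?_, fun t ht => ?_⟩
  · have hd : (0 : ℚ) < 2 ^ d := by positivity
    rw [pow_succ]
    linarith
  · simp only at h2 h3 ht ⊢
    by_cases hee : e' t = e t
    · rcases h3 t (hee ▸ ht) with h | ⟨h4, h5, h6⟩
      · exact Or.inl h
      · rw [hx h4]
        exact Or.inr ⟨h4, by omega, by omega⟩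
    · obtain ⟨hi, hne⟩ := he t hee
      have hg1 : g ≠ 1 := by
        rintro rfl
        simp at hne
      -- The address of `g` is at least `4 ^ ℓ g = 2 ^ (2 * ℓ g)`, while the position is below `2 ^
      -- d`. Hence changes of radius `ℓ g` fit in the window.
      have hlen : 2 * ℓ g ≤ d := by
        have h4 : (2 : ℚ) ^ (2 * ℓ g) < 2 ^ d := by
          rw [pow_mul, show (2 : ℚ) ^ 2 = 4 by norm_num]
          linarith [hg hg1, le_abs_self y.1]
        exact ((pow_lt_pow_iff_right₀ one_lt_two).1 h4).le
      have hl1 := hℓ.mul_le g x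
      have hl2 := hℓ.mul_le g⁻¹ (g * x)
      rw [inv_mul_cancel_left, ← hℓ.inv] at hl2
      rw [hx hi]
      refine Or.inr ⟨hi, ?_⟩
      unfold ballIndicator at hne
      by_cases ha : ℓ x ≤ t <;> by_cases hb : ℓ (g * x) ≤ t <;> simp [ha, hb] at hne <;> omega

theorem Budget.letter {ℓ : H → ℕ} (hℓ : IsLengthFunction ℓ) {γ : ℚ × ℚ → H}
    (hγ : ∀ y, γ y ≠ 1 → (4 : ℚ) ^ ℓ (γ y) ≤ y.1) {n : ℕ} {p : Point H} (hp : Budget ℓ n p)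
    {s : Equiv.Perm (Point H)}
    (hs : s ∈ generators γ (ballIndicator ℓ) ∨ s⁻¹ ∈ generators γ (ballIndicator ℓ)) :
    Budget ℓ (n + 1) (s p) := by
  have hadd : ∀ w y : ℚ × ℚ, |w.1| ≤ 1 → |(y + w).1| ≤ |y.1| + 1 := fun w y hw =>
    (abs_add_le y.1 w.1).trans (by linarith)
  have hinv : ∀ (w y : ℚ × ℚ), (Equiv.addRight w)⁻¹ y = y + -w := fun w y => by
    rw [Equiv.Perm.inv_eq_iff_eq]; simp
  have htrans : ∀ w : ℚ × ℚ, |w.1| ≤ 1 →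
      Budget ℓ (n + 1) (SkewEmbedding.movePosition (Equiv.addRight w) p) ∧
      Budget ℓ (n + 1) ((SkewEmbedding.movePosition (Equiv.addRight w))⁻¹ p) := fun w hw =>
    ⟨hp.movePosition fun y => Or.inl (hadd w y hw), by
      rw [← map_inv]
      exact hp.movePosition fun y => Or.inl (by
        rw [hinv]; exact hadd (-w) y (by rwa [Prod.fst_neg, abs_neg]))⟩
  have hdouble : Budget ℓ (n + 1) (SkewEmbedding.movePosition double p) :=
    hp.movePosition fun y => Or.inr (by
      simp [double, abs_mul])
  have hhalf : Budget ℓ (n + 1) ((SkewEmbedding.movePosition double)⁻¹ p) := by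
    rw [← map_inv]
    refine hp.movePosition fun y => Or.inl ?_
    have : (double⁻¹ y).1 = 2⁻¹ * y.1 := rfl
    rw [this, abs_mul, abs_of_pos (by norm_num : (0 : ℚ) < 2⁻¹)]
    linarith [abs_nonneg y.1]
  obtain ⟨y, i, x, e⟩ := p
  have hstep : Budget ℓ (n + 1) (stepPerm γ (ballIndicator ℓ) (y, i, x, e)) := by
    rw [stepPerm_apply]
    refine hp.changeValue hℓ (hγ y) (fun hi => if_neg (not_le.2 hi)) fun t ht => ?_
    by_cases hi : 0 ≤ i
    · simp [hi] at ht
    · refine ⟨not_le.1 hi, fun h => ht ?_⟩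
      simp [hi, h]
  have hstep' : Budget ℓ (n + 1) ((stepPerm γ (ballIndicator ℓ))⁻¹ (y, i, x, e)) := by
    rw [stepPerm_inv_apply]
    refine hp.changeValue hℓ (hγ y) (fun hi => if_neg (not_le.2 hi)) fun t ht => ?_
    by_cases hi : 0 ≤ i
    · simp [hi] at ht
    · refine ⟨not_le.1 hi, fun h => ht ?_⟩
      simp [hi, h]
  have hshift : Budget ℓ (n + 1) (shiftPerm H (y, i, x, e)) := by
    rw [shiftPerm_apply]
    exact hp.changeLevel fun hy => by simp [hy]
  have hshift' : Budget ℓ (n + 1) ((shiftPerm H)⁻¹ (y, i, x, e)) := by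
    rw [shiftPerm_inv_apply]
    exact hp.changeLevel fun hy => by simp [hy]
  have key : ∀ r ∈ generators γ (ballIndicator ℓ), Budget ℓ (n + 1) (r (y, i, x, e)) ∧
      Budget ℓ (n + 1) (r⁻¹ (y, i, x, e)) := by
    rintro r (rfl | rfl | rfl | rfl | rfl)
    · exact htrans _ (by simp)
    · exact htrans _ (by simp)
    · exact ⟨hdouble, hhalf⟩
    · exact ⟨hstep, hstep'⟩
    · exact ⟨hshift, hshift'⟩
  rcases hs with hs | hs
  · exact (key s hs).1
  · simpa using (key _ hs).2

theorem budget_word {ℓ : H → ℕ} (hℓ : IsLengthFunction ℓ) {γ : ℚ × ℚ → H}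
    (hγ : ∀ y, γ y ≠ 1 → (4 : ℚ) ^ ℓ (γ y) ≤ y.1) (w : List (Equiv.Perm (Point H)))
    (hw : ∀ s ∈ w, s ∈ generators γ (ballIndicator ℓ) ∨ s⁻¹ ∈ generators γ (ballIndicator ℓ)) :
    Budget ℓ w.length (w.prod (0, 0, 1, 0)) := by
  induction w with
  | nil => exact ⟨0, ∅, by simp, by simp, by simp⟩
  | cons s w ih =>
    rw [List.prod_cons, Equiv.Perm.mul_apply, List.length_cons]
    exact (ih fun r hr => hw r (List.mem_cons_of_mem s hr)).letter hℓ hγ (hw s (by simp))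

theorem length_le_of_prod_eq_embedPerm {ℓ : H → ℕ} (hℓ : IsLengthFunction ℓ) {γ : ℚ × ℚ → H}
    (hγ : ∀ y, γ y ≠ 1 → (4 : ℚ) ^ ℓ (γ y) ≤ y.1) {w : List (Equiv.Perm (Point H))}
    (hw : ∀ s ∈ w, s ∈ generators γ (ballIndicator ℓ) ∨ s⁻¹ ∈ generators γ (ballIndicator ℓ))
    {h : H} (hprod : w.prod = embedPerm (ballIndicator ℓ) h) : ℓ h ≤ w.length := by
  obtain ⟨d, T, h1, -, h3⟩ := budget_word hℓ hγ w hw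
  rw [hprod, embedPerm_apply, if_pos ⟨rfl, rfl⟩] at h3
  -- The final level is 0, so the window is unavailable and all `ℓ h` nonzero places of `F h - F 1`
  -- must lie in `T`.
  have hsub : Finset.range (ℓ h) ⊆ T := by
    intro t ht
    rw [Finset.mem_range] at ht
    rcases h3 t (by simp [ballIndicator, (hℓ.eq_zero_iff 1).2 rfl, not_le.2 ht]) with h | h
    · exact h
    · exact absurd h.1 (lt_irrefl _)
  have := Finset.card_le_card hsub
  rw [Finset.card_range] at this
  omega

/-! ### Upper bound for word length -/

/-- Horner's scheme in base 2: each binary digit costs a conjugation by the doubling and at most one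
unit translation, three letters in all. -/
theorem hasWord_translation {H : Type u} {X : Set (Equiv.Perm (Point H))} {v : ℚ × ℚ}
    (hv : movePosition (Equiv.addRight v) ∈ X) (hdouble : movePosition double ∈ X) (m : ℕ) :
    ∀ N : ℕ, N < 2 ^ m → HasWord X (movePosition (Equiv.addRight ((N : ℚ) • v))) (3 * m) := by
  induction m with
  | zero =>
    intro N hN
    obtain rfl : N = 0 := by simpa using hN
    have : (movePosition (Equiv.addRight (((0 : ℕ) : ℚ) • v)) : Equiv.Perm (Point H)) = 1 := by
      ext1 p; simp
    rw [this]
    exact HasWord.one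
  | succ m ih =>
    intro N hN
    have hrec := ((HasWord.of_mem hdouble).mul (ih (N / 2) (by rw [pow_succ] at hN; omega))).mul
      (HasWord.of_mem hdouble).inv
    have hdiv : (N : ℚ) = 2 * ((N / 2 : ℕ) : ℚ) + ((N % 2 : ℕ) : ℚ) := by
      exact_mod_cast (Nat.div_add_mod N 2).symm
    have hconj : (movePosition double * movePosition (Equiv.addRight (((N / 2 : ℕ) : ℚ) • v)) *
        (movePosition double)⁻¹ : Equiv.Perm (Point H)) =
        movePosition (Equiv.addRight ((2 * ((N / 2 : ℕ) : ℚ)) • v)) := by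
      rw [← map_inv, ← map_mul, ← map_mul]
      congr 1
      ext1 y
      change (2 : ℚ) • ((2⁻¹ : ℚ) • y + ((N / 2 : ℕ) : ℚ) • v) = y + (2 * ((N / 2 : ℕ) : ℚ)) • v
      rw [smul_add, smul_smul, smul_smul]
      norm_num
    rw [hconj] at hrec
    rcases Nat.mod_two_eq_zero_or_one N with h | h
    · rw [hdiv, h, Nat.cast_zero, add_zero]
      exact hrec.mono (by omega)
    · have : (movePosition (Equiv.addRight ((N : ℚ) • v)) : Equiv.Perm (Point H)) =
          movePosition (Equiv.addRight ((2 * ((N / 2 : ℕ) : ℚ)) • v)) *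
          movePosition (Equiv.addRight v) := by
        rw [← map_mul]
        congr 1
        ext1 y
        rw [Equiv.Perm.mul_apply, Equiv.coe_addRight, Equiv.coe_addRight, Equiv.coe_addRight,
          hdiv, h, add_smul, Nat.cast_one, one_smul]
        beta_reduce
        rw [← add_assoc, add_right_comm]
      rw [this]
      exact (hrec.mul (HasWord.of_mem hv)).mono (by omega)

/-- Translating to the address costs `3 * m` letters for `N` and `6 * m` for `N ^ 2`. The commutator
uses this translation or its inverse four times, together with four single letters. -/
theorem hasWord_embedPerm {γ : ℚ × ℚ → H} (F : H → ℕ → ℤ) {h : H} {N m : ℕ} (hN : N < 2 ^ m)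
    (hγ : γ ((N : ℚ), (N : ℚ) ^ 2) = h) :
    HasWord (generators γ F) (embedPerm F h) (36 * m + 4) := by
  have hN2 : N ^ 2 < 2 ^ (2 * m) := by
    rw [mul_comm, pow_mul]
    exact Nat.pow_lt_pow_left hN two_ne_zero
  have hsplit : (movePosition (Equiv.addRight ((N : ℚ), (N : ℚ) ^ 2)) : Equiv.Perm (Point H)) =
      movePosition (Equiv.addRight ((N : ℚ) • ((1, 0) : ℚ × ℚ))) *
      movePosition (Equiv.addRight (((N ^ 2 : ℕ) : ℚ) • ((0, 1) : ℚ × ℚ))) := by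
    rw [← map_mul]
    congr 1
    ext1 y
    ext <;> simp
  have hT : HasWord (generators γ F)
      (movePosition (Equiv.addRight ((N : ℚ), (N : ℚ) ^ 2))) (9 * m) := by
    rw [hsplit]
    exact ((hasWord_translation (by simp [generators]) (by simp [generators]) m N hN).mul
      (hasWord_translation (by simp [generators]) (by simp [generators]) (2 * m) _ hN2)).mono
      (by omega)
  have hs : HasWord (generators γ F) (stepPerm γ F) 1 := HasWord.of_mem (by simp [generators])
  have hb : HasWord (generators γ F) (shiftPerm H) 1 := HasWord.of_mem (by simp [generators])
  rw [embedPerm_eq_commutator γ F _ hγ]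
  exact (((((hT.inv.mul hs).mul hT).mul hb).mul ((hT.inv.mul hs.inv).mul hT)).mul hb.inv).mono
    (by omega)

/-- A function on the plane taking each value at a prescribed point of the parabola. -/
theorem exists_address {ℓ : H → ℕ} {N : H → ℕ} (hinj : Function.Injective N)
    (hN : ∀ h, 4 ^ ℓ h ≤ N h) :
    ∃ γ : ℚ × ℚ → H, (∀ y, γ y ≠ 1 → y ∈ parabola) ∧
      (∀ y, γ y ≠ 1 → (4 : ℚ) ^ ℓ (γ y) ≤ y.1) ∧ ∀ h, γ ((N h : ℚ), (N h : ℚ) ^ 2) = h := by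
  let p : H → ℚ × ℚ := fun h => ((N h : ℚ), (N h : ℚ) ^ 2)
  have hp : Function.Injective p := fun g h hgh => hinj (Nat.cast_injective (congrArg Prod.fst hgh))
  have hval : ∀ h, Function.extend p id (fun _ => 1) (p h) = h := fun h => hp.extend_apply _ _ h
  have hex : ∀ y, Function.extend p id (fun _ => 1) y ≠ 1 → ∃ h, p h = y := fun y hy => by
    by_contra hcon
    exact hy (Function.extend_apply' _ _ _ hcon)
  refine ⟨Function.extend p id fun _ => 1, fun y hy => ?_, fun y hy => ?_, hval⟩
  · obtain ⟨h, rfl⟩ := hex y hy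
    exact ⟨N h, rfl⟩
  · obtain ⟨h, rfl⟩ := hex y hy
    rw [hval]
    change (4 : ℚ) ^ ℓ h ≤ (N h : ℚ)
    exact_mod_cast hN h

end SkewEmbedding

/-! ### Assembling the embedding -/

open SkewEmbedding in
theorem theorem1p1 {H : Type u} [Group H] (ℓ : H → ℕ) (hℓ : IsLengthFunction ℓ)
    (hexp : GrowthAtMostExponential ℓ) :
    ∃ (G : Type u) (_ : Group G) (φ : H →* G) (X : Set G),
      Function.Injective φ ∧ X.Finite ∧ Subgroup.closure X = ⊤ ∧
      (∃ c : ℝ, 0 < c ∧ ∀ h : H,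
        c * (wordLength X (φ h) : ℝ) ≤ (ℓ h : ℝ) ∧ ℓ h ≤ wordLength X (φ h)) ∧
      ∃ (G₁ G₂ : Subgroup G) (_ : G₁.Normal) (_ : G₂.Normal),
        G₁ ≤ G₂ ∧
        (∀ x ∈ G₁, ∀ y ∈ G₁, x * y = y * x) ∧
        G₁ ⊓ φ.range = ⊥ ∧
        LocallyEmbedsInPowers H (G₂ ⧸ G₁.subgroupOf G₂) ∧
        derivedSeries (G ⧸ G₂) 3 = ⊥ := by
  obtain ⟨N, C, hinj, hN, hC⟩ := exists_numbering hℓ hexp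
  obtain ⟨γ, hpar, hγ, hval⟩ := exists_address hinj hN
  set F := ballIndicator ℓ with hF
  have hword : ∀ h : H, HasWord (generators γ F) (embedPerm F h) ((36 * C + 4) * ℓ h) := by
    intro h
    by_cases hh : h = 1
    · subst hh
      rw [map_one]
      exact HasWord.one.mono (Nat.zero_le _)
    · have hl : 1 ≤ ℓ h := Nat.one_le_iff_ne_zero.2 fun h0 => hh ((hℓ.eq_zero_iff h).1 h0)
      -- Here `m = C * ℓ h`, and `1 ≤ ℓ h` turns the additive 4 into a multiple of the length.
      exact (hasWord_embedPerm F (hC h hh) (hval h)).mono (by nlinarith)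
  have hmem : ∀ h : H, embedPerm F h ∈ Subgroup.closure (generators γ F) := by
    intro h
    obtain ⟨w, hw, hprod, -⟩ := hword h
    rw [← hprod]
    refine Subgroup.list_prod_mem _ fun x hx => ?_
    rcases hw x hx with h | h
    · exact Subgroup.subset_closure h
    · exact (Subgroup.inv_mem_iff _).1 (Subgroup.subset_closure h)
  have hskew : ∀ g : Subgroup.closure (generators γ F), IsSkew g.1 :=
    fun g => isSkew_of_mem_closure g.2
  have htop : Subgroup.closure (Subtype.val ⁻¹' generators γ F :
      Set (Subgroup.closure (generators γ F))) = ⊤ := Subgroup.closure_closure_coe_preimage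
  have hnormal₁ : ((valueKernel H).subgroupOf (Subgroup.closure (generators γ F))).Normal :=
    ⟨fun n hn g => (hskew g).conj_mem_valueKernel hn⟩
  have hnormal₂ : ((levelKernel H).subgroupOf (Subgroup.closure (generators γ F))).Normal :=
    ⟨fun n hn g => (hskew g).conj_mem_levelKernel hn⟩
  refine ⟨Subgroup.closure (generators γ F), inferInstance, (embedPerm F).codRestrict _ hmem,
    Subtype.val ⁻¹' generators γ F, fun g h hgh => embedPerm_injective F (congrArg Subtype.val hgh),
    ?_, htop, ⟨((36 * C + 4 : ℕ) : ℝ)⁻¹, by positivity, fun h => ⟨?_, ?_⟩⟩,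
    (valueKernel H).subgroupOf _, (levelKernel H).subgroupOf _, hnormal₁, hnormal₂,
    fun g hg => hg.1, ?_, ?_, ?_, ?_⟩
  · exact Set.Finite.preimage Subtype.val_injective.injOn (by simp [generators])
  · have hle := ((hword h).subtype (hmem h)).wordLength_le
    rw [inv_mul_le_iff₀ (by positivity)]
    exact_mod_cast hle
  · obtain ⟨w, hw, hprod, hlen⟩ :=
      exists_word_of_closure_eq_top htop ((embedPerm F).codRestrict _ hmem h)
    rw [← hlen, ← List.length_map (f := Subtype.val) (as := w)]
    refine length_le_of_prod_eq_embedPerm hℓ hγ (fun s hs => ?_) ?_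
    · obtain ⟨x, hx, rfl⟩ := List.mem_map.1 hs
      exact hw x hx
    · have := congrArg Subtype.val hprod
      simpa using this
  · intro g hg h hh
    exact Subtype.ext ((hskew g).commute_of_mem_valueKernel (hskew h) hg hh)
  · rw [eq_bot_iff]
    rintro _ ⟨hg, h, rfl⟩
    -- An element of G₁ preserves values, but `h` sends the value 1 over the origin at level 0 to
    -- `h`.
    have h1 : (embedPerm F h (0, 0, 1, 0)).2.2.1 = 1 := hg.2 (0, 0, 1, 0)
    rw [embedPerm_apply, if_pos ⟨rfl, rfl⟩, mul_one] at h1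
    rw [Subgroup.mem_bot, show h = 1 from h1, map_one]
  · exact locallyEmbedsInPowers_levelKernel γ F rfl rfl
  · exact derivedSeries_quotient_eq_bot (derivedSeries_three_le hpar F)
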